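/- Let $(\mathcal C,\otimes,I)$ be a monoidal category. A dual of an object $V$ is an object $V^\vee$ with morphisms $\mathrm{ev}\colon V^\vee\otimes V\to I$ and $\mathrm{db}\colon I\to V\otimes V^\vee$ satisfying the two triangle identities. Suppose that every object has a dual and that one has been chosen for each object. Then $V\mapsto V^\vee$ is a contravariant functor. By uniqueness of duals there are canonical isomorphisms $\zeta\colon W^\vee\otimes V^\vee\to(V\otimes W)^\vee$ and $\zeta_0\colon I\to I^\vee$, which form a monoidal functor structure on $(-)^\vee$; they induce one on the bidual functor $(-)^{\vee\vee}$. A pivotal monoidal category is a monoidal category with such a choice of duals and an isomorphism $j\colon V\to V^{\vee\vee}$ of monoidal functors $\mathrm{Id}\to(-)^{\vee\vee}$. For a (strong) monoidal functor $\mathcal F$ between monoidal categories with chosen duals, let $\tilde\xi_X\colon\mathcal F(X^\vee)\to\mathcal F(X)^\vee$ be the canonical isomorphism given by uniqueness of duals. If the categories are pivotal, $\mathcal F$ preserves the pivotal structure if $\tilde\xi_{X^\vee}\circ\mathcal F(j_X)=(\tilde\xi_X)^\vee\circ j_{\mathcal F(X)}\colon\mathcal F(X)\to\mathcal F(X^\vee)^\vee$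 for all $X$. An equivalence of pivotal monoidal categories is a monoidal equivalence (two quasi-inverse monoidal functors, with unit and counit monoidal transformations) both of whose functors preserve the pivotal structure. A strict pivotal monoidal category is a pivotal monoidal category in which the associativity and unit isomorphisms, the isomorphisms $\zeta$ and $\zeta_0$, and the pivotal structure $j$ are all identities; in particular $(U\otimes V)\otimes W=U\otimes(V\otimes W)$, $I\otimes V=V=V\otimes I$, $W^\vee\otimes V^\vee=(V\otimes W)^\vee$, $I^\vee=I$ and $V^{\vee\vee}=V$. **Theorem.** Every pivotal monoidal category is equivalent, as a pivotal monoidal category, to a strict pivotal monoidal category. (The latter can be chosen with objects and morphisms in the same universes as the former.) -/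

import Mathlib

open CategoryTheory MonoidalCategory

universe v v₁ v₂ u u₁ u₂

noncomputable section

namespace PivotalStrict

section Duality

variable {C : Type u} [Category.{v} C] [MonoidalCategory C] [RightRigidCategory C]

/-- The chosen dual `X^∨` of an object, with evaluation `X^∨ ⊗ X ⟶ 𝟙` and coevaluation
`𝟙 ⟶ X ⊗ X^∨`.  (Mathlib calls this a right dual; other conventions call it a left dual.)
The instance is written out, so that always the dual chosen by `RightRigidCategory C` is meant. -/
def dual (X : C) : C := (RightRigidCategory.rightDual X).rightDual

/-- The evaluation and coevaluation of the chosen dual. -/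
@[reducible] def dualPairing (X : C) : ExactPairing X (dual X) :=
  (RightRigidCategory.rightDual X).exact

/-- The transpose `f^∨ : Y^∨ ⟶ X^∨` of `f : X ⟶ Y` with respect to the chosen duals; together with
`dual` this is the contravariant duality functor. -/
def dualMap {X Y : C} (f : X ⟶ Y) : dual Y ⟶ dual X :=
  @rightAdjointMate C _ _ X Y (RightRigidCategory.rightDual X) (RightRigidCategory.rightDual Y) f

theorem dualMap_id (X : C) : dualMap (𝟙 X) = 𝟙 (dual X) :=
  @rightAdjointMate_id C _ _ X (RightRigidCategory.rightDual X)

theorem dualMap_comp {X Y Z : C} (f : X ⟶ Y) (g : Y ⟶ Z) :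
    dualMap (f ≫ g) = dualMap g ≫ dualMap f :=
  @comp_rightAdjointMate C _ _ X Y Z (RightRigidCategory.rightDual X)
    (RightRigidCategory.rightDual Y) (RightRigidCategory.rightDual Z) f g

variable (C) in
/-- The bidual functor `(-)^∨∨`. -/
def bidualFunctor : C ⥤ C where
  obj X := dual (dual X)
  map f := dualMap (dualMap f)
  map_id X := by rw [dualMap_id, dualMap_id]
  map_comp f g := by rw [dualMap_comp, dualMap_comp]

/-- The canonical isomorphism `ζ : Y^∨ ⊗ X^∨ ≅ (X ⊗ Y)^∨`, by uniqueness of duals: the object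
`Y^∨ ⊗ X^∨` is dual to `X ⊗ Y` by nesting the pairings of `X` and `Y`.  These isomorphisms and
`zetaUnit` are the monoidal functor structure of the duality functor. -/
def zeta (X Y : C) : dual Y ⊗ dual X ≅ dual (X ⊗ Y) :=
  rightDualIso (@ExactPairing.tensor C _ _ X Y (dual X) (dual Y) (dualPairing X) (dualPairing Y))
    (dualPairing (X ⊗ Y))

variable (C) in
/-- The canonical isomorphism `𝟙 ≅ 𝟙^∨`, by uniqueness of duals. -/
def zetaUnit : 𝟙_ C ≅ dual (𝟙_ C) :=
  rightDualIso exactPairingUnit (dualPairing (𝟙_ C))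

/-- The monoidal structure of the bidual functor,
`X^∨∨ ⊗ Y^∨∨ ⟶ (Y^∨ ⊗ X^∨)^∨ ⟶ (X ⊗ Y)^∨∨`. -/
def bidualTensor (X Y : C) : dual (dual X) ⊗ dual (dual Y) ⟶ dual (dual (X ⊗ Y)) :=
  (zeta (dual Y) (dual X)).hom ≫ dualMap (zeta X Y).inv

variable (C) in
/-- The unit part of the monoidal structure of the bidual functor. -/
def bidualUnit : 𝟙_ C ⟶ dual (dual (𝟙_ C)) :=
  (zetaUnit C).hom ≫ dualMap (zetaUnit C).inv

end Duality

/-- A pivotal structure on a monoidal category with chosen duals: an isomorphism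
`j : X ⟶ X^∨∨` of monoidal functors from the identity functor to the bidual functor. -/
class PivotalCategory (C : Type u) [Category.{v} C] [MonoidalCategory C]
    [RightRigidCategory C] where
  j : 𝟭 C ≅ bidualFunctor C
  j_tensor : ∀ X Y : C, j.hom.app (X ⊗ Y) = (j.hom.app X ⊗ₘ j.hom.app Y) ≫ bidualTensor X Y
  j_unit : j.hom.app (𝟙_ C) = bidualUnit C

/-- The pivotal isomorphism `X ⟶ X^∨∨`. -/
def pivotal {C : Type u} [Category.{v} C] [MonoidalCategory C] [RightRigidCategory C]
    [PivotalCategory C] (X : C) : X ⟶ dual (dual X) :=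
  (PivotalCategory.j (C := C)).hom.app X

/-- A strict monoidal category: associators and unitors are identities. -/
structure IsStrictMonoidal (C : Type u) [Category.{v} C] [MonoidalCategory C] : Prop where
  assoc_obj : ∀ X Y Z : C, (X ⊗ Y) ⊗ Z = X ⊗ (Y ⊗ Z)
  assoc_hom : ∀ X Y Z : C, (α_ X Y Z).hom = eqToHom (assoc_obj X Y Z)
  left_unit_obj : ∀ X : C, 𝟙_ C ⊗ X = X
  left_unit_hom : ∀ X : C, (λ_ X).hom = eqToHom (left_unit_obj X)
  right_unit_obj : ∀ X : C, X ⊗ 𝟙_ C = X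
  right_unit_hom : ∀ X : C, (ρ_ X).hom = eqToHom (right_unit_obj X)

/-- A strict pivotal monoidal category: the monoidal category is strict, the monoidal structure
of the duality functor (binary and nullary) consists of identities, and so does the pivotal
structure. -/
structure IsStrictPivotal (C : Type u) [Category.{v} C] [MonoidalCategory C]
    [RightRigidCategory C] [PivotalCategory C] : Prop extends IsStrictMonoidal C where
  zeta_obj : ∀ X Y : C, dual Y ⊗ dual X = dual (X ⊗ Y)
  zeta_hom : ∀ X Y : C, (zeta X Y).hom = eqToHom (zeta_obj X Y)
  zetaUnit_obj : 𝟙_ C = dual (𝟙_ C)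
  zetaUnit_hom : (zetaUnit C).hom = eqToHom zetaUnit_obj
  pivotal_obj : ∀ X : C, X = dual (dual X)
  pivotal_hom : ∀ X : C, pivotal X = eqToHom (pivotal_obj X)

section Functors

variable {C : Type u₁} [Category.{v₁} C] [MonoidalCategory C]
  {D : Type u₂} [Category.{v₂} D] [MonoidalCategory D]

open Functor.LaxMonoidal Functor.OplaxMonoidal in
/-- A monoidal functor maps a dual pair to a dual pair. -/
@[reducible] def mapPairing (F : C ⥤ D) [F.Monoidal] {X Y : C} (p : ExactPairing X Y) :
    ExactPairing (F.obj X) (F.obj Y) where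
  coevaluation' := ε F ≫ F.map p.coevaluation' ≫ δ F X Y
  evaluation' := μ F Y X ≫ F.map p.evaluation' ≫ η F
  coevaluation_evaluation' := by
    have h := congrArg (fun f => (F.obj Y ◁ ε F) ≫ μ F Y (𝟙_ C) ≫ F.map f ≫ δ F (𝟙_ C) Y ≫
      (η F ▷ F.obj Y)) p.coevaluation_evaluation'
    simp only [Functor.map_comp, Functor.Monoidal.map_whiskerLeft,
      Functor.Monoidal.map_whiskerRight, Functor.Monoidal.map_associator_inv,
      Functor.Monoidal.map_rightUnitor, Functor.Monoidal.map_leftUnitor_inv, Category.assoc,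
      Functor.Monoidal.μ_δ_assoc] at h
    simp only [comp_whiskerRight, MonoidalCategory.whiskerLeft_comp, Category.assoc]
    simpa using h
  evaluation_coevaluation' := by
    have h := congrArg (fun f => (ε F ▷ F.obj X) ≫ μ F (𝟙_ C) X ≫ F.map f ≫ δ F X (𝟙_ C) ≫
      (F.obj X ◁ η F)) p.evaluation_coevaluation'
    simp only [Functor.map_comp, Functor.Monoidal.map_whiskerLeft,
      Functor.Monoidal.map_whiskerRight, Functor.Monoidal.map_associator,
      Functor.Monoidal.map_leftUnitor, Functor.Monoidal.map_rightUnitor_inv, Category.assoc,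
      Functor.Monoidal.μ_δ_assoc] at h
    simp only [comp_whiskerRight, MonoidalCategory.whiskerLeft_comp, Category.assoc]
    simpa using h

variable [RightRigidCategory C] [RightRigidCategory D]

/-- The duality transformation `F(X^∨) ≅ F(X)^∨` of a monoidal functor, by uniqueness of duals. -/
def dualityTransformation (F : C ⥤ D) [F.Monoidal] (X : C) :
    F.obj (dual X) ≅ dual (F.obj X) :=
  rightDualIso (mapPairing F (dualPairing X)) (dualPairing (F.obj X))

/-- A monoidal functor between pivotal categories preserves the pivotal structure if the two
morphisms `F(X) ⟶ F(X^∨)^∨` through `F(X^∨∨)` and through `F(X)^∨∨` coincide. -/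
def PreservesPivotal [PivotalCategory C] [PivotalCategory D] (F : C ⥤ D) [F.Monoidal] : Prop :=
  ∀ X : C, F.map (pivotal X) ≫ (dualityTransformation F (dual X)).hom =
    pivotal (F.obj X) ≫ dualMap (dualityTransformation F X).hom

end Functors

/-- An equivalence of pivotal monoidal categories: a monoidal equivalence (both functors are
monoidal, unit and counit are monoidal transformations) whose functors preserve the pivotal
structures. -/
structure PivotalEquivalence (C : Type u₁) [Category.{v₁} C] [MonoidalCategory C]
    [RightRigidCategory C] [PivotalCategory C]
    (D : Type u₂) [Category.{v₂} D] [MonoidalCategory D]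
    [RightRigidCategory D] [PivotalCategory D] where
  equivalence : C ≌ D
  functorMonoidal : equivalence.functor.Monoidal
  inverseMonoidal : equivalence.inverse.Monoidal
  isMonoidal : equivalence.IsMonoidal
  functor_preserves : PreservesPivotal equivalence.functor
  inverse_preserves : PreservesPivotal equivalence.inverse

end PivotalStrict

end

/-! Words of signed objects of `C` are the objects of the strict model, and a morphism of words is a
morphism in `C` between their evaluations, so word evaluation is fully faithful and essentially
surjective. Concatenation is strictly associative and unital; reversing a word and flipping its
signs is a strict involution that reverses concatenation. The pairing of a word with its dual is
built by nesting the pairings of its letters. For a negative letter the pairing of `V^∨` with `V^∨∨`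
is transported along `j`.

What remains is that the canonical morphisms are identities. For `zeta` this follows by induction on
words from `zeta_associativity`. For `j` the identities must form a natural transformation. The
reason is that evaluation sends them to the pivotal structure of `C`: this is multiplicative
(`MapsToPivotal.tensor`), so letters suffice. A positive letter works by the choice of pairing, a
negative one because `j` at `V^∨` is inverse to the transpose of `j` at `V` (`pivotal_dual`). Since
evaluation is faithful, naturality descends, and evaluation preserves the pivotal structure; its
quasi-inverse then does so too. -/

noncomputable section

namespace PivotalStrict

/-! ### Calculus of chosen duals and pivotal structures. -/

section Calculus

variable {C : Type u} [Category.{v} C] [MonoidalCategory C]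

theorem rightDualIso_hom_evaluation {X Y₁ Y₂ : C} (p₁ : ExactPairing X Y₁)
    (p₂ : ExactPairing X Y₂) :
    (rightDualIso p₁ p₂).hom ▷ X ≫ p₂.evaluation' = p₁.evaluation' := by
  have h := @rightAdjointMate_comp_evaluation C _ _ X X ⟨Y₂⟩ ⟨Y₁⟩ (𝟙 X)
  rw [MonoidalCategory.whiskerLeft_id, Category.id_comp] at h
  exact h

variable [RightRigidCategory C]

/-- The evaluation of the chosen dual. -/
def ev (X : C) : dual X ⊗ X ⟶ 𝟙_ C := (dualPairing X).evaluation'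

/-- The coevaluation of the chosen dual. -/
def db (X : C) : 𝟙_ C ⟶ X ⊗ dual X := (dualPairing X).coevaluation'

theorem db_ev (X : C) :
    dual X ◁ db X ≫ (α_ _ _ _).inv ≫ ev X ▷ dual X = (ρ_ (dual X)).hom ≫ (λ_ (dual X)).inv :=
  (dualPairing X).coevaluation_evaluation'

theorem ev_db (X : C) :
    db X ▷ X ≫ (α_ _ _ _).hom ≫ X ◁ ev X = (λ_ X).hom ≫ (ρ_ X).inv :=
  (dualPairing X).evaluation_coevaluation'

/-- Morphisms into a dual are determined by their pairing with the object. -/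
theorem hom_ext_ev {X Z : C} {f g : Z ⟶ dual X} (h : f ▷ X ≫ ev X = g ▷ X ≫ ev X) : f = g := by
  let _ : HasRightDual X := RightRigidCategory.rightDual X
  let _ : ExactPairing X (dual X) := dualPairing X
  have h' := congrArg (tensorRightHomEquiv Z X (dual X) (𝟙_ C)) h
  have key : ∀ f : Z ⟶ dual X,
      tensorRightHomEquiv Z X (dual X) (𝟙_ C) (f ▷ X ≫ ev X) = f ≫ (λ_ _).inv :=
    fun f => tensorRightHomEquiv_whiskerRight_comp_evaluation f
  rw [key, key] at h'
  exact (cancel_mono _).1 h'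

theorem dualMap_ev {X Y : C} (f : X ⟶ Y) : dualMap f ▷ X ≫ ev X = dual Y ◁ f ≫ ev Y :=
  @rightAdjointMate_comp_evaluation C _ _ X Y (RightRigidCategory.rightDual X)
    (RightRigidCategory.rightDual Y) f

theorem zeta_ev (X Y : C) :
    (zeta X Y).hom ▷ (X ⊗ Y) ≫ ev (X ⊗ Y) = 𝟙 _ ⊗≫ dual Y ◁ (ev X ▷ Y) ⊗≫ ev Y :=
  rightDualIso_hom_evaluation _ _

theorem zetaUnit_ev : (zetaUnit C).hom ▷ 𝟙_ C ≫ ev (𝟙_ C) = (ρ_ _).hom :=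
  rightDualIso_hom_evaluation _ _

/-- After pairing with `X ⊗ Y`, each transpose slides through its evaluation onto the other factor,
first on the inner pair and then on the outer one. -/
theorem zeta_natural {X X' Y Y' : C} (f : X ⟶ X') (g : Y ⟶ Y') :
    (dualMap g ⊗ₘ dualMap f) ≫ (zeta X Y).hom = (zeta X' Y').hom ≫ dualMap (f ⊗ₘ g) := by
  apply hom_ext_ev
  rw [comp_whiskerRight, comp_whiskerRight, Category.assoc, Category.assoc, zeta_ev, dualMap_ev,
    ← whisker_exchange_assoc, zeta_ev]
  calc _ = 𝟙 ((dual Y' ⊗ dual X') ⊗ X ⊗ Y) ⊗≫ dualMap g ▷ ((dual X' ⊗ X) ⊗ Y) ⊗≫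
          dual Y ◁ (dualMap f ▷ X ≫ ev X) ▷ Y ⊗≫ ev Y := by
        rw [MonoidalCategory.tensorHom_def]; monoidal
    _ = 𝟙 ((dual Y' ⊗ dual X') ⊗ X ⊗ Y) ⊗≫ dualMap g ▷ ((dual X' ⊗ X) ⊗ Y) ⊗≫
            dual Y ◁ ((dual X' ◁ f) ≫ ev X') ▷ Y ⊗≫ ev Y := by
        rw [dualMap_ev]
    _ = 𝟙 ((dual Y' ⊗ dual X') ⊗ X ⊗ Y) ⊗≫
            (dualMap g ▷ ((dual X' ⊗ X) ⊗ Y) ≫ dual Y ◁ ((dual X' ◁ f) ≫ ev X') ▷ Y) ⊗≫ ev Y := by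
        monoidal
    _ = 𝟙 ((dual Y' ⊗ dual X') ⊗ X ⊗ Y) ⊗≫ dual Y' ◁ ((dual X' ◁ f) ≫ ev X') ▷ Y ⊗≫
            (dualMap g ▷ Y ≫ ev Y) := by
        rw [← whisker_exchange]; monoidal
    _ = 𝟙 ((dual Y' ⊗ dual X') ⊗ X ⊗ Y) ⊗≫ dual Y' ◁ ((dual X' ◁ f) ≫ ev X') ▷ Y ⊗≫
            (dual Y' ◁ g ≫ ev Y') := by
        rw [dualMap_ev]
    _ = 𝟙 ((dual Y' ⊗ dual X') ⊗ X ⊗ Y) ⊗≫ dual Y' ◁ ((dual X' ◁ f) ▷ Y ⊗≫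
            (ev X' ▷ Y ≫ 𝟙_ C ◁ g)) ⊗≫ ev Y' := by
        monoidal
    _ = _ := by rw [← whisker_exchange, MonoidalCategory.tensorHom_def]; monoidal

/-- Either bracketing pairs with the triple product by the same nested evaluations: `X` innermost,
then `Y`, then `Z`. -/
theorem zeta_associativity (X Y Z : C) :
    (α_ _ _ _).inv ≫ (zeta Y Z).hom ▷ dual X ≫ (zeta X (Y ⊗ Z)).hom ≫ dualMap (α_ X Y Z).hom =
      dual Z ◁ (zeta X Y).hom ≫ (zeta (X ⊗ Y) Z).hom := by
  apply hom_ext_ev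
  simp only [comp_whiskerRight, Category.assoc]
  rw [dualMap_ev, ← whisker_exchange_assoc, zeta_ev, zeta_ev]
  calc _ = 𝟙 ((dual Z ⊗ dual Y ⊗ dual X) ⊗ (X ⊗ Y) ⊗ Z) ⊗≫
          ((zeta Y Z).hom ▷ ((dual X ⊗ X) ⊗ Y ⊗ Z) ≫ dual (Y ⊗ Z) ◁ (ev X ▷ (Y ⊗ Z))) ⊗≫
          ev (Y ⊗ Z) := by monoidal
    _ = 𝟙 ((dual Z ⊗ dual Y ⊗ dual X) ⊗ (X ⊗ Y) ⊗ Z) ⊗≫ (dual Z ⊗ dual Y) ◁ (ev X ▷ (Y ⊗ Z)) ⊗≫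
          ((zeta Y Z).hom ▷ (Y ⊗ Z) ≫ ev (Y ⊗ Z)) := by rw [← whisker_exchange]; monoidal
    _ = 𝟙 ((dual Z ⊗ dual Y ⊗ dual X) ⊗ (X ⊗ Y) ⊗ Z) ⊗≫
            dual Z ◁ (𝟙 ((dual Y ⊗ dual X) ⊗ X ⊗ Y) ⊗≫ dual Y ◁ (ev X ▷ Y) ⊗≫ ev Y) ▷ Z ⊗≫
              ev Z := by
        rw [zeta_ev]; monoidal
    _ = 𝟙 ((dual Z ⊗ dual Y ⊗ dual X) ⊗ (X ⊗ Y) ⊗ Z) ⊗≫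
            dual Z ◁ ((zeta X Y).hom ▷ (X ⊗ Y) ≫ ev (X ⊗ Y)) ▷ Z ⊗≫ ev Z := by
        rw [zeta_ev]
    _ = _ := by monoidal

theorem zeta_unit_left (X : C) :
    dual X ◁ (zetaUnit C).hom ≫ (zeta (𝟙_ C) X).hom = (ρ_ _).hom ≫ dualMap (λ_ X).hom := by
  apply hom_ext_ev
  simp only [comp_whiskerRight, Category.assoc]
  rw [dualMap_ev, zeta_ev]
  calc _ = 𝟙 _ ⊗≫ dual X ◁ ((zetaUnit C).hom ▷ 𝟙_ C ≫ ev (𝟙_ C)) ▷ X ⊗≫ ev X := by monoidal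
    _ = _ := by rw [zetaUnit_ev]; monoidal

/-- The transpose of the evaluation of `X` is the coevaluation of the dual of `X`. -/
theorem zetaUnit_dualMap_ev (X : C) :
    (zetaUnit C).hom ≫ dualMap (ev X) = db (dual X) ≫ (zeta (dual X) X).hom := by
  apply hom_ext_ev
  simp only [comp_whiskerRight, Category.assoc]
  rw [dualMap_ev, ← whisker_exchange_assoc, zetaUnit_ev, zeta_ev]
  symm
  calc _ = 𝟙 _ ⊗≫ (db (dual X) ▷ dual X ≫ (α_ _ _ _).hom ≫ dual X ◁ ev (dual X)) ▷ X ⊗≫ ev X := by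
        monoidal
    _ = _ := by rw [ev_db]; monoidal

/-- The transpose of the coevaluation of `X` is the evaluation of the dual of `X`. -/
theorem zeta_dualMap_db (X : C) :
    (zeta X (dual X)).hom ≫ dualMap (db X) = ev (dual X) ≫ (zetaUnit C).hom := by
  apply hom_ext_ev
  simp only [comp_whiskerRight, Category.assoc]
  rw [dualMap_ev, ← whisker_exchange_assoc, zetaUnit_ev, zeta_ev]
  calc _ = 𝟙 _ ⊗≫ dual (dual X) ◁ (dual X ◁ db X ≫ (α_ _ _ _).inv ≫ ev X ▷ dual X) ⊗≫
        ev (dual X) := by monoidal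
    _ = _ := by rw [db_ev]; monoidal

theorem dualMap_eqToHom {X Y : C} (h : X = Y) :
    dualMap (eqToHom h) = eqToHom (congrArg dual h).symm := by
  subst h
  simp [dualMap_id]

/-- The first transpose turns an evaluation into a coevaluation and the second turns that back into
an evaluation, now of `X^∨∨`. -/
theorem bidualTensor_bidual_ev (X : C) :
    bidualTensor (dual X) X ≫ dualMap (dualMap (ev X)) = ev (dual (dual X)) ≫ bidualUnit C := by
  have h : dualMap (ev X) ≫ (zeta (dual X) X).inv = (zetaUnit C).inv ≫ db (dual X) := by
    rw [Iso.comp_inv_eq, Category.assoc, ← zetaUnit_dualMap_ev, Iso.inv_hom_id_assoc]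
  rw [bidualTensor, Category.assoc, ← dualMap_comp, h, dualMap_comp, ← Category.assoc,
    zeta_dualMap_db, bidualUnit, Category.assoc]

variable [PivotalCategory C]

theorem pivotal_natural {X Y : C} (f : X ⟶ Y) :
    f ≫ pivotal Y = pivotal X ≫ dualMap (dualMap f) :=
  (PivotalCategory.j (C := C)).hom.naturality f

theorem pivotal_tensor (X Y : C) :
    pivotal (X ⊗ Y) = (pivotal X ⊗ₘ pivotal Y) ≫ bidualTensor X Y :=
  PivotalCategory.j_tensor X Y

theorem pivotal_unit : pivotal (𝟙_ C) = bidualUnit C := PivotalCategory.j_unit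

instance (X : C) : IsIso (pivotal X) :=
  inferInstanceAs (IsIso ((PivotalCategory.j (C := C)).hom.app X))

/-- This is naturality of `j` at `ev X`, rewritten by monoidality of `j`; the invertible component
at the unit cancels. -/
theorem pivotal_ev (X : C) :
    (pivotal (dual X) ⊗ₘ pivotal X) ≫ ev (dual (dual X)) = ev X := by
  have h := pivotal_natural (ev X)
  rw [pivotal_unit, pivotal_tensor, Category.assoc, bidualTensor_bidual_ev, ← pivotal_unit,
    ← Category.assoc] at h
  exact ((cancel_mono _).1 h).symm

/-- The pivotal isomorphism of a dual is inverse to the transpose of the pivotal isomorphism. -/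
theorem pivotal_dual (X : C) : pivotal (dual X) ≫ dualMap (pivotal X) = 𝟙 (dual X) := by
  apply hom_ext_ev
  rw [comp_whiskerRight, Category.assoc, dualMap_ev, ← Category.assoc,
    ← MonoidalCategory.tensorHom_def,
    pivotal_ev, id_whiskerRight, Category.id_comp]

end Calculus

/-! ### Monoidal functors and the duality transformation. -/

section MonoidalFunctors

open Functor.LaxMonoidal Functor.OplaxMonoidal

variable {C : Type u₁} [Category.{v₁} C] [MonoidalCategory C] [RightRigidCategory C]
  {D : Type u₂} [Category.{v₂} D] [MonoidalCategory D] [RightRigidCategory D]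
  (F : C ⥤ D) [F.Monoidal]

theorem dualityTransformation_ev (X : C) :
    (dualityTransformation F X).hom ▷ F.obj X ≫ ev (F.obj X) =
      μ F _ _ ≫ F.map (ev X) ≫ η F :=
  rightDualIso_hom_evaluation _ _

theorem dualityTransformation_natural {X Y : C} (f : X ⟶ Y) :
    F.map (dualMap f) ≫ (dualityTransformation F X).hom =
      (dualityTransformation F Y).hom ≫ dualMap (F.map f) := by
  apply hom_ext_ev
  rw [comp_whiskerRight, comp_whiskerRight, Category.assoc, Category.assoc,
    dualityTransformation_ev, dualMap_ev, ← whisker_exchange_assoc, dualityTransformation_ev,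
    μ_natural_left_assoc, μ_natural_right_assoc, ← F.map_comp_assoc, ← F.map_comp_assoc,
    dualMap_ev]

/-- Both sides pair with `F X ⊗ F Y` to the image of the nested evaluation; the proof evaluates the
two pairings (`hR`, `hL`) and matches them by the coherence of `F`. -/
theorem dualityTransformation_tensor (X Y : C) :
    ((dualityTransformation F Y).hom ⊗ₘ (dualityTransformation F X).hom) ≫
        (zeta (F.obj X) (F.obj Y)).hom =
      μ F _ _ ≫ F.map (zeta X Y).hom ≫ (dualityTransformation F (X ⊗ Y)).hom ≫
        dualMap (μ F X Y) := by
  have hR : (μ F (dual Y) (dual X) ≫ F.map (zeta X Y).hom ≫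
      (dualityTransformation F (X ⊗ Y)).hom ≫ dualMap (μ F X Y)) ▷ (F.obj X ⊗ F.obj Y) ≫
        ev (F.obj X ⊗ F.obj Y) =
      μ F (dual Y) (dual X) ▷ (F.obj X ⊗ F.obj Y) ≫ F.obj (dual Y ⊗ dual X) ◁ μ F X Y ≫
        μ F _ _ ≫ F.map (𝟙 ((dual Y ⊗ dual X) ⊗ X ⊗ Y) ⊗≫ dual Y ◁ (ev X ▷ Y) ⊗≫ ev Y) ≫ η F := by
    rw [← zeta_ev, F.map_comp, Category.assoc, ← μ_natural_left_assoc, whisker_exchange_assoc,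
      ← dualityTransformation_ev]
    simp only [comp_whiskerRight, Category.assoc]
    rw [dualMap_ev, whisker_exchange_assoc]
  have hL : ((dualityTransformation F Y).hom ⊗ₘ (dualityTransformation F X).hom) ▷
        (F.obj X ⊗ F.obj Y) ≫ (zeta (F.obj X) (F.obj Y)).hom ▷ (F.obj X ⊗ F.obj Y) ≫
        ev (F.obj X ⊗ F.obj Y) =
      𝟙 ((F.obj (dual Y) ⊗ F.obj (dual X)) ⊗ F.obj X ⊗ F.obj Y) ⊗≫
        F.obj (dual Y) ◁ (μ F _ _ ≫ F.map (ev X) ≫ η F) ▷ F.obj Y ⊗≫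
          (μ F _ _ ≫ F.map (ev Y) ≫ η F) := by
    rw [zeta_ev, ← dualityTransformation_ev, ← dualityTransformation_ev]
    calc _ = 𝟙 ((F.obj (dual Y) ⊗ F.obj (dual X)) ⊗ F.obj X ⊗ F.obj Y) ⊗≫
            F.obj (dual Y) ◁ ((dualityTransformation F X).hom ▷ F.obj X) ▷ F.obj Y ⊗≫
            ((dualityTransformation F Y).hom ▷ ((dual (F.obj X) ⊗ F.obj X) ⊗ F.obj Y) ≫
              dual (F.obj Y) ◁ (ev (F.obj X) ▷ F.obj Y)) ⊗≫ ev (F.obj Y) := by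
          rw [MonoidalCategory.tensorHom_def']; monoidal
      _ = _ := by rw [← whisker_exchange]; monoidal
  apply hom_ext_ev
  rw [hR, comp_whiskerRight, Category.assoc, hL]
  simp [monoidalComp, -MonoidalCategory.whiskerRight_tensor]
  have h : F.obj (dual X) ◁ μ F X Y ≫ μ F (dual X) (X ⊗ Y) ≫ F.map (α_ (dual X) X Y).inv ≫
      F.map (ev X ▷ Y) ≫ F.map (λ_ Y).hom = (α_ _ _ _).inv ≫ μ F (dual X) X ▷ F.obj Y ≫
        F.map (ev X) ▷ F.obj Y ≫ η F ▷ F.obj Y ≫ ε F ▷ F.obj Y ≫ μ F (𝟙_ C) Y ≫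
          F.map (λ_ Y).hom := by
    simp
  rw [← whisker_exchange_assoc, Functor.LaxMonoidal.associativity_assoc,
    associator_naturality_right_assoc]
  simp only [← μ_natural_right_assoc]
  simp only [← MonoidalCategory.whiskerLeft_comp_assoc]
  rw [h]

theorem dualityTransformation_unit :
    ε F ≫ F.map (zetaUnit C).hom ≫ (dualityTransformation F (𝟙_ C)).hom ≫ dualMap (ε F) =
      (zetaUnit D).hom := by
  apply hom_ext_ev
  simp only [comp_whiskerRight, Category.assoc]
  rw [dualMap_ev, ← whisker_exchange_assoc, dualityTransformation_ev, zetaUnit_ev,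
    ← whisker_exchange_assoc, μ_natural_left_assoc, ← F.map_comp_assoc, zetaUnit_ev]
  simp

/-! ### Detecting a pivotal structure through a monoidal functor. -/

section Pivotal

variable [PivotalCategory D]

/-- The functor `F` maps the morphism `p : X ⟶ X^∨∨` to the pivotal isomorphism of `F X`, up to
the duality transformation. -/
def MapsToPivotal {X : C} (p : X ⟶ dual (dual X)) : Prop :=
  F.map p ≫ (dualityTransformation F (dual X)).hom =
    pivotal (F.obj X) ≫ dualMap (dualityTransformation F X).hom

variable {F}

theorem MapsToPivotal.tensor {X Y : C} {p : X ⟶ dual (dual X)} {q : Y ⟶ dual (dual Y)}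
    (hp : MapsToPivotal F p) (hq : MapsToPivotal F q) :
    MapsToPivotal F ((p ⊗ₘ q) ≫ bidualTensor X Y) := by
  unfold MapsToPivotal at *
  have h : F.map (zeta X Y).inv ≫ δ F (dual Y) (dual X) ≫
      ((dualityTransformation F Y).hom ⊗ₘ (dualityTransformation F X).hom) =
        (dualityTransformation F (X ⊗ Y)).hom ≫ dualMap (μ F X Y) ≫
          (zeta (F.obj X) (F.obj Y)).inv := by
    have := dualityTransformation_tensor F X Y
    rw [← cancel_mono (zeta (F.obj X) (F.obj Y)).hom]
    simp only [Category.assoc, Iso.inv_hom_id, Category.comp_id]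
    rw [this, Functor.Monoidal.δ_μ_assoc, ← F.map_comp_assoc, Iso.inv_hom_id, F.map_id,
      Category.id_comp]
  have h' : μ F (dual (dual X)) (dual (dual Y)) ≫ F.map (zeta (dual Y) (dual X)).hom ≫
      (dualityTransformation F (dual Y ⊗ dual X)).hom =
        ((dualityTransformation F (dual X)).hom ⊗ₘ (dualityTransformation F (dual Y)).hom) ≫
          (zeta (F.obj (dual Y)) (F.obj (dual X))).hom ≫ dualMap (δ F (dual Y) (dual X)) := by
    rw [reassoc_of% dualityTransformation_tensor F (dual Y) (dual X), ← dualMap_comp]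
    simp [dualMap_id]
  rw [← cancel_epi (μ F X Y), reassoc_of% pivotal_natural, pivotal_tensor, bidualTensor,
    bidualTensor]
  simp only [Functor.map_comp, Category.assoc]
  rw [dualityTransformation_natural, ← μ_natural_assoc, reassoc_of% h',
    MonoidalCategory.tensorHom_comp_tensorHom_assoc, hp, hq,
    ← MonoidalCategory.tensorHom_comp_tensorHom_assoc, reassoc_of% zeta_natural]
  simp only [← dualMap_comp, Category.assoc]
  rw [h]

theorem mapsToPivotal_unit : MapsToPivotal F (bidualUnit C) := by
  unfold MapsToPivotal
  have h : F.map (zetaUnit C).inv ≫ η F =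
      (dualityTransformation F (𝟙_ C)).hom ≫ dualMap (ε F) ≫ (zetaUnit D).inv := by
    rw [← Category.assoc, Iso.eq_comp_inv, ← dualityTransformation_unit F]
    simp [← Functor.map_comp_assoc]
  have h' : F.map (zetaUnit C).hom ≫ (dualityTransformation F (𝟙_ C)).hom =
      η F ≫ (zetaUnit D).hom ≫ dualMap (η F) := by
    rw [← dualityTransformation_unit F]
    simp [← dualMap_comp, dualMap_id]
  rw [← cancel_epi (ε F), reassoc_of% pivotal_natural, pivotal_unit, bidualUnit, bidualUnit,
    F.map_comp, Category.assoc, dualityTransformation_natural, reassoc_of% h']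
  simp only [Category.assoc, ← dualMap_comp]
  rw [← h]
  simp

/-- The family `p` is not assumed natural, and `C` need not be pivotal: naturality is inherited from
the pivotal structure of `D`. This is what makes the identities on words a natural transformation.
-/
theorem MapsToPivotal.naturality [F.Faithful] {p : ∀ X : C, X ⟶ dual (dual X)}
    (hp : ∀ X, MapsToPivotal F (p X)) {X Y : C} (f : X ⟶ Y) :
    f ≫ p Y = p X ≫ dualMap (dualMap f) := by
  unfold MapsToPivotal at hp
  apply F.map_injective
  rw [← cancel_mono (dualityTransformation F (dual Y)).hom]
  simp only [Functor.map_comp, Category.assoc]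
  rw [hp, dualityTransformation_natural, reassoc_of% hp, reassoc_of% pivotal_natural,
    ← dualMap_comp,
    ← dualMap_comp, dualityTransformation_natural]

end Pivotal

/-! ### Passing preservation of the pivotal structure to a quasi-inverse. -/

section Equivalence

variable (G : D ⥤ C) [G.Monoidal]

/-- A monoidal natural transformation is compatible with evaluations, so both composites have the
same pairing with `F (G X)`. -/
theorem dualityTransformation_of_iso_id (c : G ⋙ F ≅ 𝟭 D) [NatTrans.IsMonoidal c.hom] (X : D) :
    F.map (dualityTransformation G X).hom ≫ (dualityTransformation F (G.obj X)).hom =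
      c.hom.app (dual X) ≫ dualMap (c.hom.app X) := by
  have h1 := NatTrans.IsMonoidal.tensor (τ := c.hom) (dual X) X
  have h2 := NatTrans.IsMonoidal.unit (τ := c.hom)
  have h3 := c.hom.naturality (ev X)
  simp only [Functor.LaxMonoidal.comp_μ] at h1
  simp at h1 h2 h3
  have h4 : c.hom.app (𝟙_ D) = F.map (η G) ≫ η F := by
    rw [← cancel_epi (F.map (ε G)), ← cancel_epi (ε F), h2]
    simp
  apply hom_ext_ev
  simp only [comp_whiskerRight, Category.assoc]
  rw [dualityTransformation_ev, μ_natural_left_assoc, ← F.map_comp_assoc,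
    dualityTransformation_ev]
  change _ = c.hom.app (dual X) ▷ (G ⋙ F).obj X ≫ dualMap (c.hom.app X) ▷ (G ⋙ F).obj X ≫
    ev ((G ⋙ F).obj X)
  rw [dualMap_ev]
  have h5 : μ F (G.obj (dual X)) (G.obj X) ≫ F.map (μ G (dual X) X) ≫
      c.hom.app (dual X ⊗ X) ≫ ev X =
        c.hom.app (dual X) ▷ (G ⋙ F).obj X ≫ dual X ◁ c.hom.app X ≫ ev X := by
    rw [reassoc_of% h1]
    exact MonoidalCategory.tensorHom_def_assoc _ _ _
  refine Eq.trans ?_ h5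
  simp only [Functor.map_comp, Category.assoc]
  rw [← h3, h4]

theorem PreservesPivotal.of_iso_id [PivotalCategory C] [PivotalCategory D] [F.Faithful]
    (c : G ⋙ F ≅ 𝟭 D) [NatTrans.IsMonoidal c.hom] (hF : PreservesPivotal F) : PreservesPivotal G := by
  intro X
  have h := dualityTransformation_of_iso_id F G c
  apply F.map_injective
  rw [← cancel_mono (dualityTransformation F _).hom]
  simp only [Functor.map_comp, Category.assoc]
  rw [h, dualityTransformation_natural, reassoc_of% (hF (G.obj X)), ← dualMap_comp, h,
    dualMap_comp, ← reassoc_of% pivotal_natural]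
  exact c.hom.naturality_assoc _ _

end Equivalence

end MonoidalFunctors

/-- Needed because a one-letter word receives its pairing as a tensor product with the pairing of
the empty word. -/
theorem tensor_unit_evaluation {C : Type u} [Category.{v} C] [MonoidalCategory C] {X Y : C}
    (p : ExactPairing X Y) :
    (@ExactPairing.tensor C _ _ X (𝟙_ C) Y (𝟙_ C) p exactPairingUnit).evaluation' =
      ((λ_ Y).hom ⊗ₘ (ρ_ X).hom) ≫ p.evaluation' := by
  refine (@ExactPairing.tensor_evaluation C _ _ X (𝟙_ C) Y (𝟙_ C) p exactPairingUnit).trans ?_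
  have h : ε_ (𝟙_ C) (𝟙_ C) = (ρ_ (𝟙_ C)).hom := rfl
  change _ = _ ≫ @ExactPairing.evaluation C _ _ X Y p
  rw [h, MonoidalCategory.tensorHom_def]
  monoidal

/-! ### The strict involution on signed words. -/

section DualWords

variable {C : Type u}

/-- The letter with the opposite sign. -/
def flipSign (x : C × Bool) : C × Bool := (x.1, !x.2)

theorem flipSign_flipSign (x : C × Bool) : flipSign (flipSign x) = x := by
  simp [flipSign]

/-- The dual word: the order is reversed and all signs are flipped. -/
def dualWord : List (C × Bool) → List (C × Bool)
  | [] => []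
  | x :: l => dualWord l ++ [flipSign x]

theorem dualWord_append (l m : List (C × Bool)) :
    dualWord (l ++ m) = dualWord m ++ dualWord l := by
  induction l with
  | nil => simp [dualWord]
  | cons x l ih => simp [dualWord, ih]

theorem dualWord_dualWord (l : List (C × Bool)) : dualWord (dualWord l) = l := by
  induction l with
  | nil => rfl
  | cons x l ih => simp [dualWord, dualWord_append, ih, flipSign_flipSign]

end DualWords

/-! ### The strict monoidal category of words. -/

section Words

variable {C : Type u} [Category.{v} C] [MonoidalCategory C] [RightRigidCategory C]

/-- The object named by a signed object: the object itself, or its dual. -/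
def letterObj : C × Bool → C
  | (V, true) => V
  | (V, false) => dual V

/-- The object named by a word of signed objects: the tensor product of its letters. -/
def wordObj : List (C × Bool) → C
  | [] => 𝟙_ C
  | x :: l => letterObj x ⊗ wordObj l

/-- Concatenation of words is the tensor product. -/
def wordTensor : ∀ l m : List (C × Bool), wordObj l ⊗ wordObj m ≅ wordObj (l ++ m)
  | [], m => λ_ (wordObj m)
  | x :: l, m => α_ (letterObj x) (wordObj l) (wordObj m) ≪≫
      whiskerLeftIso (letterObj x) (wordTensor l m)

theorem wordTensor_assoc (l m n : List (C × Bool)) :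
    (wordTensor l m).hom ▷ wordObj n ≫ (wordTensor (l ++ m) n).hom ≫
        eqToHom (congrArg wordObj (List.append_assoc l m n)) =
      (α_ _ _ _).hom ≫ wordObj l ◁ (wordTensor m n).hom ≫ (wordTensor l (m ++ n)).hom := by
  induction l with
  | nil =>
    change (λ_ _).hom ▷ _ ≫ (wordTensor m n).hom ≫ 𝟙 _ = (α_ _ _ _).hom ≫
      𝟙_ C ◁ (wordTensor m n).hom ≫ (λ_ _).hom
    simp
  | cons x l ih =>
    -- The transport fixes the first letter, so it is the whiskering of the transport for the tail.
    have h : eqToHom (congrArg wordObj (List.append_assoc (x :: l) m n)) =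
        letterObj x ◁ eqToHom (congrArg wordObj (List.append_assoc l m n)) :=
      (whiskerLeft_eqToHom _ _).symm
    rw [h]
    change ((α_ (letterObj x) (wordObj l) (wordObj m)).hom ≫
        letterObj x ◁ (wordTensor l m).hom) ▷ wordObj n ≫
      ((α_ (letterObj x) (wordObj (l ++ m)) (wordObj n)).hom ≫
        letterObj x ◁ (wordTensor (l ++ m) n).hom) ≫ _ =
      (α_ (letterObj x ⊗ wordObj l) _ _).hom ≫
        (letterObj x ⊗ wordObj l) ◁ (wordTensor m n).hom ≫
        (α_ (letterObj x) (wordObj l) (wordObj (m ++ n))).hom ≫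
        letterObj x ◁ (wordTensor l (m ++ n)).hom
    have ih' := congrArg (letterObj x ◁ ·) ih
    simp only [MonoidalCategory.whiskerLeft_comp] at ih'
    simp [-whiskerLeft_eqToHom, ih']

theorem wordTensor_nil (l : List (C × Bool)) :
    (wordTensor l []).hom ≫ eqToHom (congrArg wordObj (List.append_nil l)) =
      (ρ_ (wordObj l)).hom := by
  induction l with
  | nil =>
    change (λ_ _).hom ≫ 𝟙 _ = (ρ_ (𝟙_ C)).hom
    rw [Category.comp_id, unitors_equal]
  | cons x l ih =>
    have h : eqToHom (congrArg wordObj (List.append_nil (x :: l))) =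
        letterObj x ◁ eqToHom (congrArg wordObj (List.append_nil l)) :=
      (whiskerLeft_eqToHom _ _).symm
    rw [h]
    have ih' := congrArg (letterObj x ◁ ·) ih
    simp only [MonoidalCategory.whiskerLeft_comp] at ih'
    exact (Category.assoc _ _ _).trans ((congrArg
      ((α_ (letterObj x) (wordObj l) (𝟙_ C)).hom ≫ ·) ih').trans (rightUnitor_tensor_hom _ _).symm)

variable (C) in
/-- The strictification of `C`: its objects are words of signed objects, its morphisms are the
morphisms in `C` between the objects named by the words. -/
abbrev Strictification : Type u := InducedCategory C (wordObj (C := C))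

variable (C) in
/-- The functor that evaluates words. -/
abbrev evalFunctor : Strictification C ⥤ C := inducedFunctor wordObj

theorem hom_eqToHom {X Y : Strictification C} (h : X = Y) :
    (eqToHom h).hom = eqToHom (congrArg wordObj h) := by
  subst h
  rfl

instance : MonoidalCategoryStruct (Strictification C) where
  tensorObj := List.append
  tensorUnit := []
  whiskerLeft X _ _ f :=
    ⟨(wordTensor X _).inv ≫ wordObj X ◁ f.hom ≫ (wordTensor X _).hom⟩
  whiskerRight f Y :=
    ⟨(wordTensor _ Y).inv ≫ f.hom ▷ wordObj Y ≫ (wordTensor _ Y).hom⟩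
  tensorHom f g :=
    ⟨(wordTensor _ _).inv ≫ (f.hom ⊗ₘ g.hom) ≫ (wordTensor _ _).hom⟩
  associator X Y Z := eqToIso (List.append_assoc X Y Z)
  leftUnitor X := eqToIso (List.nil_append X)
  rightUnitor X := eqToIso (List.append_nil X)

variable (C) in
/-- Word evaluation preserves the tensor product. -/
def evalData : Monoidal.InducingFunctorData (evalFunctor C) where
  μIso X Y := wordTensor X Y
  εIso := Iso.refl _
  whiskerLeft_eq _ _ _ _ := rfl
  whiskerRight_eq _ _ := rfl
  tensorHom_eq _ _ := rfl
  associator_eq X Y Z := by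
    have h : ∀ X Y Z : List (C × Bool), eqToHom (congrArg wordObj (List.append_assoc X Y Z)) =
        ((wordTensor (X ++ Y) Z).inv ≫ ((wordTensor X Y).inv ⊗ₘ 𝟙 (wordObj Z))) ≫
          (α_ (wordObj X) (wordObj Y) (wordObj Z)).hom ≫
            (𝟙 (wordObj X) ⊗ₘ (wordTensor Y Z).hom) ≫ (wordTensor X (Y ++ Z)).hom := by
      intro X Y Z
      rw [id_tensorHom, tensorHom_id, ← wordTensor_assoc]
      simp
    exact (hom_eqToHom (List.append_assoc X Y Z)).trans (h X Y Z)
  leftUnitor_eq X := by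
    refine (hom_eqToHom (List.nil_append X)).trans ?_
    change 𝟙 _ = ((λ_ (wordObj X)).inv ≫ (𝟙 _ ⊗ₘ 𝟙 _)) ≫ (λ_ (wordObj X)).hom
    simp
  rightUnitor_eq X := by
    refine (hom_eqToHom (List.append_nil X)).trans ?_
    change _ = ((wordTensor X []).inv ≫ (𝟙 (wordObj X) ⊗ₘ 𝟙 (wordObj []))) ≫ (ρ_ (wordObj X)).hom
    rw [← wordTensor_nil]
    simp

instance : MonoidalCategory (Strictification C) := Monoidal.induced _ (evalData C)

instance : (evalFunctor C).Monoidal := Monoidal.fromInducedMonoidal _ (evalData C)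

theorem isStrictMonoidal_strictification : IsStrictMonoidal (Strictification C) where
  assoc_obj := List.append_assoc
  assoc_hom _ _ _ := rfl
  left_unit_obj := List.nil_append
  left_unit_hom _ := rfl
  right_unit_obj := List.append_nil
  right_unit_hom _ := rfl

end Words

/-- A monoidal equivalence that preserves the pivotal structure is, read backwards, an equivalence
of pivotal categories. -/
def PivotalEquivalence.ofInverse {C : Type u₁} [Category.{v₁} C] [MonoidalCategory C]
    [RightRigidCategory C] [PivotalCategory C] {D : Type u₂} [Category.{v₂} D] [MonoidalCategory D]
    [RightRigidCategory D] [PivotalCategory D] (e : D ≌ C) [e.functor.Monoidal]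
    (h : PreservesPivotal e.functor) : PivotalEquivalence C D :=
  letI := e.inverseMonoidal
  haveI : e.IsMonoidal := @Adjunction.instIsMonoidal _ _ _ _ _ _ _ _ e.toAdjunction _
  { equivalence := e.symm
    functorMonoidal := inferInstanceAs e.inverse.Monoidal
    inverseMonoidal := inferInstanceAs e.functor.Monoidal
    isMonoidal := Equivalence.isMonoidal_symm e
    functor_preserves :=
      haveI : NatTrans.IsMonoidal e.counitIso.hom := inferInstanceAs (NatTrans.IsMonoidal e.counit)
      PreservesPivotal.of_iso_id e.functor e.inverse e.counitIso h
    inverse_preserves := h }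

/-! ### Strict duals and the strict pivotal structure on words. -/

section Strictification

variable {C : Type u} [Category.{v} C] [MonoidalCategory C] [RightRigidCategory C]

/-- The pairing of a letter with the letter of the opposite sign; the dual of a dual is the object
itself by means of the pivotal structure. -/
@[reducible] def letterPairing [PivotalCategory C] :
    ∀ x : C × Bool, ExactPairing (letterObj x) (letterObj (flipSign x))
  | (V, true) => dualPairing V
  | (V, false) => @exactPairingCongrRight C _ _ (dual V) V (dual (dual V)) (dualPairing (dual V))
      (asIso (pivotal V))

/-- The strictification of a letter. -/
def singleton (x : C × Bool) : Strictification C := [x]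

variable [PivotalCategory C]

/-- The pairing of a one-letter word with the word of the opposite letter. -/
@[reducible] def singletonPairing (x : C × Bool) :
    ExactPairing (singleton x) (singleton (flipSign x)) :=
  @ExactPairing.ofFullyFaithful _ _ _ _ _ _ (evalFunctor C) _ _ _ (singleton x)
    (singleton (flipSign x))
    (@exactPairingCongr C _ _ _ _ _ _ (letterPairing x) (ρ_ (letterObj x))
      (ρ_ (letterObj (flipSign x))))

open Functor.LaxMonoidal Functor.OplaxMonoidal in
theorem singletonPairing_evaluation (x : C × Bool) :
    μ (evalFunctor C) _ _ ≫ (evalFunctor C).map (singletonPairing x).evaluation' ≫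
        η (evalFunctor C) =
      ((ρ_ (letterObj (flipSign x))).hom ⊗ₘ (ρ_ (letterObj x)).hom) ≫
        (letterPairing x).evaluation' := by
  have h : (evalFunctor C).map (singletonPairing x).evaluation' = δ (evalFunctor C) _ _ ≫
      (_ ◁ (ρ_ (letterObj x)).hom ≫ (ρ_ (letterObj (flipSign x))).hom ▷ letterObj x ≫
        (letterPairing x).evaluation') ≫ ε (evalFunctor C) :=
    (evalFunctor C).map_preimage _
  have h' : ∀ f, μ (evalFunctor C) (singleton (flipSign x)) (singleton x) ≫
      (δ (evalFunctor C) _ _ ≫ f ≫ ε (evalFunctor C)) ≫ η (evalFunctor C) = f := by simp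
  rw [h, MonoidalCategory.tensorHom_def']
  exact (h' _).trans (Category.assoc _ _ _).symm

/-- The pairing of a word with its dual word. -/
@[reducible] def wordPairing : ∀ l : Strictification C,
    ExactPairing l (dualWord l : Strictification C)
  | [] => exactPairingUnit
  | x :: l => @ExactPairing.tensor (Strictification C) _ _ (singleton x) l
      (singleton (flipSign x)) (dualWord l) (singletonPairing x) (wordPairing l)

instance : RightRigidCategory (Strictification C) where
  rightDual X := { rightDual := dualWord X, exact := wordPairing X }

theorem zetaUnit_strictification : zetaUnit (Strictification C) = Iso.refl _ :=
  rightDualIso_id _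

theorem ev_singleton (x : C × Bool) : ev (singleton x) = (singletonPairing x).evaluation' := by
  refine (tensor_unit_evaluation (singletonPairing x)).trans ?_
  change (𝟙 _ ⊗ₘ 𝟙 _) ≫ _ = _
  rw [id_tensorHom_id]
  exact Category.id_comp _

theorem dual_tensor_strictification (X Y : Strictification C) :
    dual Y ⊗ dual X = dual (X ⊗ Y) := (dualWord_append X Y).symm

/-- The pairing of `x :: l` is by definition the nesting of the pairings of `x` and `l`, so the
identity already has the evaluation that characterises `zeta`. -/
theorem zeta_singleton (x : C × Bool) (l : Strictification C) :
    (zeta (singleton x) l).hom = eqToHom (dual_tensor_strictification (singleton x) l) := by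
  refine Eq.trans ?_ (show 𝟙 _ = _ from rfl)
  apply hom_ext_ev
  refine (zeta_ev _ _).trans (Eq.trans ?_ ((congrArg (· ≫ ev (singleton x ⊗ l))
    (id_whiskerRight _ _)).trans (Category.id_comp _)).symm)
  rw [ev_singleton]
  rfl

theorem zeta_strictification (X Y : Strictification C) :
    (zeta X Y).hom = eqToHom (dual_tensor_strictification X Y) := by
  have hS := isStrictMonoidal_strictification (C := C)
  induction X with
  | nil =>
    have h := zeta_unit_left Y
    rw [zetaUnit_strictification] at h
    refine ((congrArg (· ≫ (zeta (𝟙_ _) Y).hom) (whiskerLeft_id _ _)).trans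
      (Category.id_comp _)).symm.trans (h.trans ?_)
    rw [hS.left_unit_hom, hS.right_unit_hom, dualMap_eqToHom]
    exact eqToHom_trans _ _
  | cons x l ih =>
    -- Of the four `zeta`s here, two have a singleton as first argument and one is covered by `ih`;
    -- the fourth is the goal.
    have h := zeta_associativity (singleton x) l Y
    rw [zeta_singleton, zeta_singleton, ih, Iso.inv_comp_eq, hS.assoc_hom, hS.assoc_hom,
      dualMap_eqToHom, eqToHom_whiskerRight, whiskerLeft_eqToHom, eqToHom_trans, eqToHom_trans,
      eqToHom_trans_assoc, eq_comm, eqToHom_comp_iff, eqToHom_trans] at h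
    exact h

theorem bidual_strictification (X : Strictification C) : X = dual (dual X) :=
  (dualWord_dualWord X).symm

theorem bidualTensor_strictification (X Y : Strictification C) :
    bidualTensor X Y = eqToHom (by
      rw [← bidual_strictification, ← bidual_strictification, ← bidual_strictification]) := by
  have h : (zeta X Y).inv = eqToHom (dual_tensor_strictification X Y).symm := by
    rw [← cancel_epi (zeta X Y).hom, Iso.hom_inv_id, zeta_strictification, eqToHom_trans,
      eqToHom_refl]
  rw [bidualTensor, h, zeta_strictification, dualMap_eqToHom, eqToHom_trans]

theorem bidualUnit_strictification :
    bidualUnit (Strictification C) = eqToHom (bidual_strictification _) := by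
  rw [bidualUnit, zetaUnit_strictification]
  exact (Category.id_comp _).trans (dualMap_id (𝟙_ (Strictification C)))

theorem eqToHom_tensor_bidualTensor (X Y : Strictification C) :
    eqToHom (bidual_strictification (X ⊗ Y)) =
      (eqToHom (bidual_strictification X) ⊗ₘ eqToHom (bidual_strictification Y)) ≫
        bidualTensor X Y := by
  rw [bidualTensor_strictification, MonoidalCategory.tensorHom_def, eqToHom_whiskerRight,
    whiskerLeft_eqToHom, eqToHom_trans, eqToHom_trans]

/-- Up to right unitors, the comparison for a letter is the map `e` relating its pairing to the
chosen one: the identity for positive letters, `pivotal V` for negative ones. -/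
theorem dualityTransformation_singleton (x : C × Bool) (e : letterObj (flipSign x) ⟶
    dual (letterObj x)) (he : e ▷ letterObj x ≫ ev (letterObj x) = (letterPairing x).evaluation') :
    (dualityTransformation (evalFunctor C) (singleton x)).hom =
      (ρ_ (letterObj (flipSign x))).hom ≫ e ≫ dualMap (ρ_ (letterObj x)).hom := by
  apply hom_ext_ev
  rw [dualityTransformation_ev, ev_singleton]
  refine (singletonPairing_evaluation x).trans ?_
  rw [← he]
  symm
  change ((ρ_ (letterObj (flipSign x))).hom ≫ e ≫ dualMap (ρ_ (letterObj x)).hom) ▷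
    (letterObj x ⊗ 𝟙_ C) ≫ ev (letterObj x ⊗ 𝟙_ C) = _
  rw [comp_whiskerRight, comp_whiskerRight, Category.assoc, Category.assoc, dualMap_ev,
    ← whisker_exchange_assoc, MonoidalCategory.tensorHom_def, Category.assoc]

theorem dualityTransformation_singleton_true (V : C) :
    (dualityTransformation (evalFunctor C) (singleton (V, true))).hom =
      (ρ_ (dual V)).hom ≫ dualMap (ρ_ V).hom := by
  refine (dualityTransformation_singleton (V, true) (𝟙 (dual V)) ?_).trans ?_
  · exact (congrArg (· ≫ ev V) (id_whiskerRight _ _)).trans (Category.id_comp _)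
  · exact congrArg ((ρ_ (dual V)).hom ≫ ·) (Category.id_comp _)

theorem dualityTransformation_singleton_false (V : C) :
    (dualityTransformation (evalFunctor C) (singleton (V, false))).hom =
      (ρ_ V).hom ≫ pivotal V ≫ dualMap (ρ_ (dual V)).hom :=
  dualityTransformation_singleton (V, false) (pivotal V) rfl

theorem mapsToPivotal_singleton (x : C × Bool) :
    MapsToPivotal (evalFunctor C) (eqToHom (bidual_strictification (singleton x))) := by
  obtain ⟨V, _ | _⟩ := x
  · change 𝟙 _ ≫ (dualityTransformation (evalFunctor C) (singleton (V, true))).hom =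
      pivotal (dual V ⊗ 𝟙_ C) ≫
        dualMap (dualityTransformation (evalFunctor C) (singleton (V, false))).hom
    rw [dualityTransformation_singleton_true, dualityTransformation_singleton_false]
    refine (Category.id_comp _).trans ?_
    change (ρ_ (dual V)).hom ≫ dualMap (ρ_ V).hom =
      pivotal (dual V ⊗ 𝟙_ C) ≫ dualMap ((ρ_ V).hom ≫ pivotal V ≫ dualMap (ρ_ (dual V)).hom)
    -- For a negative letter the transpose of `pivotal V` meets the pivotal map of `V^∨`, and the
    -- two cancel.
    rw [dualMap_comp, dualMap_comp, Category.assoc, ← reassoc_of% pivotal_natural,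
      reassoc_of% pivotal_dual]
  · change 𝟙 _ ≫ (dualityTransformation (evalFunctor C) (singleton (V, false))).hom =
      pivotal (V ⊗ 𝟙_ C) ≫
        dualMap (dualityTransformation (evalFunctor C) (singleton (V, true))).hom
    rw [dualityTransformation_singleton_true, dualityTransformation_singleton_false]
    refine (Category.id_comp _).trans ?_
    change (ρ_ V).hom ≫ pivotal V ≫ dualMap (ρ_ (dual V)).hom =
      pivotal (V ⊗ 𝟙_ C) ≫ dualMap ((ρ_ (dual V)).hom ≫ dualMap (ρ_ V).hom)
    rw [dualMap_comp, ← reassoc_of% pivotal_natural]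

theorem mapsToPivotal_strictification (X : Strictification C) :
    MapsToPivotal (evalFunctor C) (eqToHom (bidual_strictification X)) := by
  induction X with
  | nil =>
    have h := mapsToPivotal_unit (F := evalFunctor C)
    rw [bidualUnit_strictification] at h
    exact h
  | cons x l ih =>
    have h := (mapsToPivotal_singleton x).tensor ih
    rw [← eqToHom_tensor_bidualTensor] at h
    exact h

instance : PivotalCategory (Strictification C) where
  j := NatIso.ofComponents (fun X => eqToIso (bidual_strictification X))
    (fun f => MapsToPivotal.naturality mapsToPivotal_strictification f)
  j_tensor := eqToHom_tensor_bidualTensor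
  j_unit := bidualUnit_strictification.symm

theorem isStrictPivotal_strictification : IsStrictPivotal (Strictification C) where
  toIsStrictMonoidal := isStrictMonoidal_strictification
  zeta_obj := dual_tensor_strictification
  zeta_hom := zeta_strictification
  zetaUnit_obj := rfl
  zetaUnit_hom := by
    rw [zetaUnit_strictification]
    rfl
  pivotal_obj := bidual_strictification
  pivotal_hom _ := rfl

theorem preservesPivotal_evalFunctor : PreservesPivotal (evalFunctor C) :=
  mapsToPivotal_strictification

instance : (evalFunctor C).EssSurj where
  mem_essImage V := ⟨singleton (V, true), ⟨ρ_ V⟩⟩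

instance : (evalFunctor C).IsEquivalence where

variable (C) in
/-- A pivotal category is equivalent to its strictification. -/
def strictificationEquivalence : PivotalEquivalence C (Strictification C) :=
  @PivotalEquivalence.ofInverse _ _ _ _ _ _ _ _ _ _ (evalFunctor C).asEquivalence
    (inferInstance : (evalFunctor C).Monoidal) preservesPivotal_evalFunctor

end Strictification

end PivotalStrict

end
open PivotalStrict in
theorem mainTheorem3 (C : Type u) [Category.{v} C] [MonoidalCategory C] [RightRigidCategory C]
    [PivotalCategory C] :
    ∃ (D : Type u) (_ : Category.{v} D) (_ : MonoidalCategory D) (_ : RightRigidCategory D)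
      (_ : PivotalCategory D),
      IsStrictPivotal D ∧ Nonempty (PivotalEquivalence C D) :=
  ⟨Strictification C, inferInstance, inferInstance, inferInstance, inferInstance,
    isStrictPivotal_strictification, ⟨strictificationEquivalence C⟩⟩
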